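/- Let $N\ge 1$, $\alpha\in(0,1)$, $q\in(2N/\alpha,\infty)$, let $\Omega\subset\mathbb{R}^N$ be a bounded Lipschitz domain (a bounded, nonempty, connected open set which near each boundary point is, after a rotation, the region strictly above the graph of a Lipschitz function), and let $\varphi\in C^{0,\alpha}(\partial\Omega)$. For $u\in L^q(\Omega)$ say that $u=\varphi$ on $\partial\Omega$ if $u$ has a (necessarily unique) representative that is continuous on $\overline\Omega$ and this representative equals $\varphi$ on $\partial\Omega$. For $p>2N/\alpha$ put $$X^{\varphi}_{\alpha,p}(\Omega)=\Big\{u\in L^q(\Omega):\Big(\int_{\Omega\times\Omega}\frac{|u(x)-u(y)|^p}{|x-y|^{\alpha p}}\,dx\,dy\Big)^{1/p}<\infty,\ u=\varphi\text{ on }\partial\Omega\Big\},$$ $$X^{\varphi}_{\alpha,\infty}(\overline\Omega)=\Big\{u\in L^q(\Omega):\sup_{x,y\in\overline\Omega,\,x\ne y}\frac{|u(x)-u(y)|}{|x-y|^{\alpha}}<\infty,\ u=\varphi\text{ on }\partial\Omega\Big\},$$ where in the second set $u$ denotes its continuous representative on $\overline\Omega$. Define $E^{\varphi}_{\alpha,p},\overline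 E^{\varphi}_{\alpha,\infty}:L^q(\Omega)\to[0,\infty]$ by $$E^{\varphi}_{\alpha,p}(u)=\Big(\int_{\Omega\times\Omega}\frac{|u(x)-u(y)|^p}{|x-y|^{\alpha p}}\,dx\,dy\Big)^{1/p}\ \text{if }u\in X^{\varphi}_{\alpha,p}(\Omega),\qquad E^{\varphi}_{\alpha,p}(u)=\infty\ \text{otherwise},$$ $$\overline E^{\varphi}_{\alpha,\infty}(u)=\sup_{x,y\in\overline\Omega,\,x\ne y}\frac{|u(x)-u(y)|}{|x-y|^{\alpha}}\ \text{if }u\in X^{\varphi}_{\alpha,\infty}(\overline\Omega),\qquad \overline E^{\varphi}_{\alpha,\infty}(u)=\infty\ \text{otherwise}.$$ Let $(p_n)_{n}$ be any sequence of real numbers $p_n>2N/\alpha$ with $p_n\to+\infty$. Then: (i) $E^{\varphi}_{\alpha,p_n}$ $\Gamma(L^q(\Omega))$-converges to $\overline E^{\varphi}_{\alpha,\infty}$, that is: for all $u_n\to u$ in $L^q(\Omega)$, $\overline E^{\varphi}_{\alpha,\infty}(u)\le\liminf_{n\to\infty}E^{\varphi}_{\alpha,p_n}(u_n)$; and for every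 $u\in L^q(\Omega)$ there is a sequence $u_n\to u$ in $L^q(\Omega)$ with $\limsup_{n\to\infty}E^{\varphi}_{\alpha,p_n}(u_n)\le\overline E^{\varphi}_{\alpha,\infty}(u)$. (ii) If, for each $n$, $u_n$ is a minimizer of $E^{\varphi}_{\alpha,p_n}$ in $X^{\varphi}_{\alpha,p_n}(\Omega)$, and $u_n\to u$ strongly in $L^q(\Omega)$, then $u\in X^{\varphi}_{\alpha,\infty}(\overline\Omega)$ and $u$ is a minimizer of $\overline E^{\varphi}_{\alpha,\infty}$ in $X^{\varphi}_{\alpha,\infty}(\overline\Omega)$. -/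

import Mathlib

open MeasureTheory Filter Topology Set
open scoped ENNReal NNReal

noncomputable section

/-- Sequential `Γ`-convergence of functionals `F n : X → [0, ∞]` to `G : X → [0, ∞]` on a metric
space: the liminf inequality along every convergent sequence, and existence of recovery
sequences. -/
def GammaConverges {X : Type*} [MetricSpace X] (F : ℕ → X → ℝ≥0∞) (G : X → ℝ≥0∞) : Prop :=
  (∀ (u : X) (w : ℕ → X), Tendsto w atTop (𝓝 u) →
    G u ≤ liminf (fun n => F n (w n)) atTop) ∧
  (∀ u : X, ∃ w : ℕ → X, Tendsto w atTop (𝓝 u) ∧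
    limsup (fun n => F n (w n)) atTop ≤ G u)

/-- `u` is a minimizer of `F` in the admissible set `A`. -/
def IsMinimizerIn {X : Type*} (F : X → ℝ≥0∞) (A : Set X) (u : X) : Prop :=
  u ∈ A ∧ ∀ v ∈ A, F u ≤ F v

/-- Bounded Lipschitz domains: bounded, open, connected, nonempty sets which near every boundary
point are the strict epigraph of a Lipschitz function over a hyperplane. The unit vector `e` is
the vertical direction, `x - ⟪e, x⟫ e` is the orthogonal projection of `x` to the hyperplane
orthogonal to `e`, and `γ` is only evaluated on that hyperplane. -/
structure IsBoundedLipschitzDomain {N : ℕ} (Ω : Set (EuclideanSpace ℝ (Fin N))) : Prop where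
  isOpen : IsOpen Ω
  isConnected : IsConnected Ω
  isBounded : Bornology.IsBounded Ω
  locally_epigraph : ∀ x₀ ∈ frontier Ω,
    ∃ (r : ℝ) (e : EuclideanSpace ℝ (Fin N)) (K : ℝ≥0) (γ : EuclideanSpace ℝ (Fin N) → ℝ),
      0 < r ∧ ‖e‖ = 1 ∧ LipschitzWith K γ ∧
      ∀ x ∈ Metric.ball x₀ r, (x ∈ Ω ↔ γ (x - (inner ℝ e x : ℝ) • e) < (inner ℝ e x : ℝ))

/-- `L^q(Ω)` for Lebesgue measure on `Ω ⊆ ℝ^N`. -/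
abbrev LqSpace {N : ℕ} (Ω : Set (EuclideanSpace ℝ (Fin N))) (q : ℝ) : Type :=
  Lp ℝ (ENNReal.ofReal q) ((volume : Measure (EuclideanSpace ℝ (Fin N))).restrict Ω)

/-- `g` is a representative of `u ∈ L^q(Ω)` that is continuous up to the boundary. -/
def IsContinuousRep {N : ℕ} {Ω : Set (EuclideanSpace ℝ (Fin N))} {q : ℝ}
    (u : LqSpace Ω q) (g : EuclideanSpace ℝ (Fin N) → ℝ) : Prop :=
  ContinuousOn g (closure Ω) ∧ u =ᵐ[volume.restrict Ω] g

/-- `u = φ` on `∂Ω`, in the sense of the continuous representative of `u` on the closure. -/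
def HasBoundaryValues {N : ℕ} {Ω : Set (EuclideanSpace ℝ (Fin N))} {q : ℝ}
    (u : LqSpace Ω q) (φ : EuclideanSpace ℝ (Fin N) → ℝ) : Prop :=
  ∃ g, IsContinuousRep u g ∧ EqOn g φ (frontier Ω)

/-- `(∫_{Ω × Ω} |u(x) - u(y)|^p / |x - y|^{α p} dx dy)^{1/p}`, with values in `[0, ∞]`. -/
def fracEnergy {N : ℕ} {Ω : Set (EuclideanSpace ℝ (Fin N))} {q : ℝ} (α p : ℝ)
    (u : LqSpace Ω q) : ℝ≥0∞ :=
  (∫⁻ z, ENNReal.ofReal (|u z.1 - u z.2| ^ p / ‖z.1 - z.2‖ ^ (α * p))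
    ∂((volume.restrict Ω).prod (volume.restrict Ω))) ^ (1 / p)

/-- `sup_{x, y ∈ S, x ≠ y} |g(x) - g(y)| / |x - y|^α`, with values in `[0, ∞]`. -/
def holderSup {N : ℕ} (α : ℝ) (S : Set (EuclideanSpace ℝ (Fin N)))
    (g : EuclideanSpace ℝ (Fin N) → ℝ) : ℝ≥0∞ :=
  ⨆ (x ∈ S) (y ∈ S) (_ : x ≠ y), ENNReal.ofReal (|g x - g y| / ‖x - y‖ ^ α)

/-- The `α`-Hölder seminorm on the closure of `Ω` of the continuous representative of `u`; it is
`∞` if there is no such representative. For open `Ω` all continuous representatives agree on the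
closure, so the infimum is the value at any of them: see `holderClosure_eq`. -/
def holderClosure {N : ℕ} {Ω : Set (EuclideanSpace ℝ (Fin N))} {q : ℝ} (α : ℝ)
    (u : LqSpace Ω q) : ℝ≥0∞ :=
  ⨅ (g : EuclideanSpace ℝ (Fin N) → ℝ) (_ : IsContinuousRep u g), holderSup α (closure Ω) g

theorem IsContinuousRep.eqOn {N : ℕ} {Ω : Set (EuclideanSpace ℝ (Fin N))} {q : ℝ}
    (hΩ : IsOpen Ω) {u : LqSpace Ω q} {g h : EuclideanSpace ℝ (Fin N) → ℝ}
    (hg : IsContinuousRep u g) (hh : IsContinuousRep u h) : EqOn g h (closure Ω) := by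
  have h1 : EqOn g h Ω :=
    Measure.eqOn_open_of_ae_eq (hg.2.symm.trans hh.2) hΩ
      (hg.1.mono subset_closure) (hh.1.mono subset_closure)
  exact h1.of_subset_closure hg.1 hh.1 subset_closure subset_rfl

theorem holderClosure_eq {N : ℕ} {Ω : Set (EuclideanSpace ℝ (Fin N))} {q : ℝ} (α : ℝ)
    (hΩ : IsOpen Ω) {u : LqSpace Ω q} {g : EuclideanSpace ℝ (Fin N) → ℝ}
    (hg : IsContinuousRep u g) : holderClosure α u = holderSup α (closure Ω) g := by
  refine le_antisymm (iInf₂_le g hg) (le_iInf₂ fun h hh => le_of_eq ?_)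
  have hgh := hg.eqOn hΩ hh
  unfold holderSup
  refine iSup_congr fun x => iSup_congr fun hx => iSup_congr fun y => iSup_congr fun hy => ?_
  rw [hgh hx, hgh hy]

/-- The admissible set `X^φ_{α,p}(Ω)`, as a subset of `L^q(Ω)`. -/
def admissible {N : ℕ} (Ω : Set (EuclideanSpace ℝ (Fin N))) (q α p : ℝ)
    (φ : EuclideanSpace ℝ (Fin N) → ℝ) : Set (LqSpace Ω q) :=
  {u | fracEnergy α p u < ∞ ∧ HasBoundaryValues u φ}

/-- The admissible set `X^φ_{α,∞}` on the closure of `Ω`, as a subset of `L^q(Ω)`. -/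
def admissibleInfty {N : ℕ} (Ω : Set (EuclideanSpace ℝ (Fin N))) (q α : ℝ)
    (φ : EuclideanSpace ℝ (Fin N) → ℝ) : Set (LqSpace Ω q) :=
  {u | holderClosure α u < ∞ ∧ HasBoundaryValues u φ}

open Classical in
/-- The constrained fractional energy `E^φ_{α,p}` on `L^q(Ω)`. -/
def constrainedEnergy {N : ℕ} (Ω : Set (EuclideanSpace ℝ (Fin N))) (q α p : ℝ)
    (φ : EuclideanSpace ℝ (Fin N) → ℝ) (u : LqSpace Ω q) : ℝ≥0∞ :=
  if u ∈ admissible Ω q α p φ then fracEnergy α p u else ∞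

open Classical in
/-- The constrained Hölder energy on the closure of `Ω`, on `L^q(Ω)`. -/
def constrainedEnergyInfty {N : ℕ} (Ω : Set (EuclideanSpace ℝ (Fin N))) (q α : ℝ)
    (φ : EuclideanSpace ℝ (Fin N) → ℝ) (u : LqSpace Ω q) : ℝ≥0∞ :=
  if u ∈ admissibleInfty Ω q α φ then holderClosure α u else ∞

end

/-! The kernel `|x - y| ^ (α p)` is exactly the `p`-th power of `|x - y| ^ α`, so the energy is the
`L^p` norm on `Ω × Ω` of the Hölder quotient, and the theorem is a version of "`L^p` norms tend to
the sup norm".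

Liminf inequality: if the energies stay below `L` and `M > L`, Markov's inequality gives the set
where the quotient of `w n` is at least `M` measure at most `(L / M) ^ p n → 0`. Along an a.e.
convergent subsequence the quotient of the limit is therefore a.e. at most `M`, and an a.e. Hölder
function has a Hölder representative (`exists_holder_rep`).

The boundary condition is the delicate point, since `L^q` convergence does not see `∂Ω`. A Lipschitz
boundary point `x₀` carries an interior cone. The averages of `w n` over balls at heights `t` and `t
/ 2` in it differ by at most `C L t ^ (α / 2)`, with `C` independent of `n`
(`exists_dist_average_half_le`). Summing over dyadic heights, the average at height `t` is close to
`φ x₀` uniformly in `n`. This estimate passes to the `L^q` limit, and then `t → 0`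
(`eqOn_frontier_of_tendsto`).

Constant sequences are recovery sequences because `|Ω| ^ (2 / p) → 1`. Minimality then passes to the
limit, and a Hölder extension of `φ` shows that the limit problem has a finite competitor. -/

/-- The `α`-Hölder difference quotient `|f x - f y| / |x - y|^α`. -/
noncomputable def holderQuotient {E : Type*} [NormedAddCommGroup E] (α : ℝ) (f : E → ℝ)
    (z : E × E) : ℝ :=
  |f z.1 - f z.2| / ‖z.1 - z.2‖ ^ α

/-! ### Hölder quotients and extension of Hölder functions -/

section Holder

variable {E : Type*} [NormedAddCommGroup E] {α : ℝ} {f : E → ℝ}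

theorem holderQuotient_nonneg (z : E × E) : 0 ≤ holderQuotient α f z := by
  unfold holderQuotient; positivity

theorem holderQuotient_le_iff {M : ℝ} (hM : 0 ≤ M) (x y : E) :
    holderQuotient α f (x, y) ≤ M ↔ |f x - f y| ≤ M * ‖x - y‖ ^ α := by
  unfold holderQuotient
  by_cases h : x = y
  · subst h
    simp only [sub_self, abs_zero, zero_div]
    exact ⟨fun _ => by positivity, fun _ => hM⟩
  · rw [div_le_iff₀ (Real.rpow_pos_of_pos (norm_pos_iff.2 (sub_ne_zero.2 h)) _)]

theorem abs_sub_le_holderQuotient_mul (x y : E) :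
    |f x - f y| ≤ holderQuotient α f (x, y) * ‖x - y‖ ^ α :=
  (holderQuotient_le_iff (holderQuotient_nonneg _) x y).1 le_rfl

/-- McShane extension for the snowflake metric `|x - y| ^ α`, which is a metric because `α ≤ 1` and
for which Hölder means Lipschitz. The constant `M` is preserved. -/
theorem exists_holder_extension (hα0 : 0 < α) (hα1 : α ≤ 1) {S : Set E} {M : ℝ} (hM : 0 ≤ M)
    (hf : ∀ x ∈ S, ∀ y ∈ S, |f x - f y| ≤ M * ‖x - y‖ ^ α) :
    ∃ g : E → ℝ, EqOn f g S ∧ ∀ x y, |g x - g y| ≤ M * ‖x - y‖ ^ α := by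
  let X := Metric.Snowflaking E α hα0 hα1
  have hL : LipschitzOnWith M.toNNReal (fun x : X => f x.ofSnowflaking)
      (Metric.Snowflaking.ofSnowflaking ⁻¹' S) := by
    refine LipschitzOnWith.of_dist_le_mul fun x hx y hy => ?_
    have hd : dist x y = ‖x.ofSnowflaking - y.ofSnowflaking‖ ^ α := by
      rw [← dist_eq_norm, Metric.Snowflaking.dist_ofSnowflaking_ofSnowflaking,
        ← Real.rpow_mul dist_nonneg, inv_mul_cancel₀ hα0.ne', Real.rpow_one]
    rw [Real.dist_eq, Real.coe_toNNReal _ hM, hd]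
    exact hf _ hx _ hy
  obtain ⟨g, hg, hgf⟩ := hL.extend_real
  refine ⟨fun x => g (Metric.Snowflaking.toSnowflaking x), fun x hx => ?_, fun x y => ?_⟩
  · exact hgf (x := Metric.Snowflaking.toSnowflaking x) (by simpa using hx)
  · have := hg.dist_le_mul (Metric.Snowflaking.toSnowflaking x)
      (Metric.Snowflaking.toSnowflaking y)
    rwa [Real.dist_eq, Real.coe_toNNReal _ hM, Metric.Snowflaking.dist_toSnowflaking_toSnowflaking,
      dist_eq_norm] at this

theorem continuous_of_holder (hα0 : 0 < α) {M : ℝ}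
    (hf : ∀ x y, |f x - f y| ≤ M * ‖x - y‖ ^ α) : Continuous f := by
  refine continuous_iff_continuousAt.2 fun a => ?_
  rw [ContinuousAt, tendsto_iff_dist_tendsto_zero]
  have h : Tendsto (fun x => M * ‖x - a‖ ^ α) (𝓝 a) (𝓝 (M * ‖a - a‖ ^ α)) :=
    (Continuous.mul continuous_const
      ((continuous_id.sub continuous_const).norm.rpow_const fun _ => Or.inr hα0.le)).tendsto a
  rw [sub_self, norm_zero, Real.zero_rpow hα0.ne', mul_zero] at h
  exact squeeze_zero (fun _ => dist_nonneg) (fun x => by rw [Real.dist_eq]; exact hf x a) h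

end Holder

/-! ### The energy as an `L^p` norm, and its bound by the Hölder constant -/

section Energy

variable {N : ℕ} {Ω : Set (EuclideanSpace ℝ (Fin N))} {q α : ℝ}

theorem holderSup_le_iff {S : Set (EuclideanSpace ℝ (Fin N))}
    {g : EuclideanSpace ℝ (Fin N) → ℝ} {M : ℝ} (hM : 0 ≤ M) :
    holderSup α S g ≤ ENNReal.ofReal M ↔
      ∀ x ∈ S, ∀ y ∈ S, |g x - g y| ≤ M * ‖x - y‖ ^ α := by
  simp only [holderSup, iSup_le_iff, ENNReal.ofReal_le_ofReal_iff hM]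
  refine forall₂_congr fun x _ => forall₂_congr fun y _ => ?_
  have := holderQuotient_le_iff (α := α) (f := g) hM x y
  unfold holderQuotient at this
  rw [← this]
  by_cases h : x = y
  · subst h; simpa using hM
  · simp [h]

theorem fracEnergy_eq_eLpNorm {p : ℝ} (hp : 0 < p) (u : LqSpace Ω q) :
    fracEnergy α p u = eLpNorm (holderQuotient α u) (ENNReal.ofReal p)
      ((volume.restrict Ω).prod (volume.restrict Ω)) := by
  rw [eLpNorm_eq_lintegral_rpow_enorm_toReal (by simpa using hp) ENNReal.ofReal_ne_top,
    ENNReal.toReal_ofReal hp.le, fracEnergy]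
  congr 1
  refine lintegral_congr fun z => ?_
  rw [Real.enorm_eq_ofReal (holderQuotient_nonneg z),
    ENNReal.ofReal_rpow_of_nonneg (holderQuotient_nonneg z) hp.le, holderQuotient,
    Real.div_rpow (abs_nonneg _) (by positivity), ← Real.rpow_mul (norm_nonneg _)]

theorem aestronglyMeasurable_holderQuotient (u : LqSpace Ω q) :
    AEStronglyMeasurable (holderQuotient α u)
      ((volume.restrict Ω).prod (volume.restrict Ω)) := by
  have hu := Lp.aestronglyMeasurable u
  have h1 : AEMeasurable (fun z : EuclideanSpace ℝ (Fin N) × EuclideanSpace ℝ (Fin N) =>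
      |u z.1 - u z.2|) ((volume.restrict Ω).prod (volume.restrict Ω)) :=
    (hu.comp_fst.sub hu.comp_snd).norm.aemeasurable
  exact (h1.div (by fun_prop : Measurable _).aemeasurable).aestronglyMeasurable

theorem fracEnergy_le_of_holder {p : ℝ} (hp : 0 < p) {u : LqSpace Ω q}
    {g : EuclideanSpace ℝ (Fin N) → ℝ} (hug : u =ᵐ[volume.restrict Ω] g) (hΩ : MeasurableSet Ω)
    {M : ℝ} (hM : 0 ≤ M) (hg : ∀ x ∈ Ω, ∀ y ∈ Ω, |g x - g y| ≤ M * ‖x - y‖ ^ α) :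
    fracEnergy α p u ≤ (volume Ω * volume Ω) ^ p⁻¹ * ENNReal.ofReal M := by
  rw [fracEnergy_eq_eLpNorm hp]
  refine (eLpNorm_le_of_ae_bound (C := M) ?_).trans (le_of_eq ?_)
  · have hg' : ∀ᵐ x ∂(volume.restrict Ω), u x = g x ∧ x ∈ Ω :=
      hug.and (ae_restrict_mem hΩ)
    filter_upwards [Measure.quasiMeasurePreserving_fst.ae hg',
      Measure.quasiMeasurePreserving_snd.ae hg'] with z h1 h2
    rw [Real.norm_of_nonneg (holderQuotient_nonneg z), holderQuotient_le_iff hM, h1.1, h2.1]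
    exact hg _ h1.2 _ h2.2
  · rw [ENNReal.toReal_ofReal hp.le, ← univ_prod_univ, Measure.prod_prod,
      Measure.restrict_apply_univ]

theorem tendsto_rpow_inv_mul {c b : ℝ≥0∞} (hc0 : c ≠ 0) (hc : c ≠ ∞) (hb : b ≠ ∞) {p : ℕ → ℝ}
    (hp : Tendsto p atTop atTop) : Tendsto (fun n => c ^ (p n)⁻¹ * b) atTop (𝓝 b) := by
  have h : Tendsto (fun n => c ^ (p n)⁻¹) atTop (𝓝 (c ^ (0 : ℝ))) := by
    lift c to ℝ≥0 using hc
    have hc0' : c ≠ 0 := by simpa using hc0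
    simp only [← ENNReal.coe_rpow_of_ne_zero hc0']
    refine ENNReal.tendsto_coe.2 ?_
    exact ((NNReal.continuousAt_rpow (Or.inl hc0')).tendsto.comp
      (tendsto_const_nhds.prodMk_nhds (tendsto_inv_atTop_zero.comp hp)))
  simpa using ENNReal.Tendsto.mul_const h (Or.inr hb)

end Energy

/-! ### From bounded energies to a Hölder representative of the limit -/

section Limit

variable {N : ℕ} {Ω : Set (EuclideanSpace ℝ (Fin N))} {q α : ℝ}

theorem tendsto_holderQuotient {E : Type*} [NormedAddCommGroup E] {w : ℕ → E → ℝ} {u : E → ℝ}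
    {z : E × E} (h1 : Tendsto (fun k => w k z.1) atTop (𝓝 (u z.1)))
    (h2 : Tendsto (fun k => w k z.2) atTop (𝓝 (u z.2))) :
    Tendsto (fun k => holderQuotient α (w k) z) atTop (𝓝 (holderQuotient α u z)) :=
  ((h1.sub h2).abs).div_const _

theorem measure_holderQuotient_ge_le {p L M : ℝ} (hp : 0 < p) (hM : 0 < M) {u : LqSpace Ω q}
    (hu : fracEnergy α p u ≤ ENNReal.ofReal L) :
    ((volume.restrict Ω).prod (volume.restrict Ω)) {z | M ≤ holderQuotient α u z} ≤
      (ENNReal.ofReal (L / M)) ^ p := by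
  rw [fracEnergy_eq_eLpNorm hp] at hu
  have hM' : ENNReal.ofReal M ≠ 0 := by simpa using hM
  have h := mul_meas_ge_le_pow_eLpNorm' ((volume.restrict Ω).prod (volume.restrict Ω))
    (p := ENNReal.ofReal p) (by simpa using hp) ENNReal.ofReal_ne_top
    (aestronglyMeasurable_holderQuotient (α := α) u) (ENNReal.ofReal M)
  rw [ENNReal.toReal_ofReal hp.le] at h
  have hset : {z | M ≤ holderQuotient α u z} =
      {z | ENNReal.ofReal M ≤ ‖holderQuotient α u z‖ₑ} := by
    ext z
    simp only [mem_ofPred_eq]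
    rw [Real.enorm_eq_ofReal (holderQuotient_nonneg z),
      ENNReal.ofReal_le_ofReal_iff (holderQuotient_nonneg z)]
  rw [ENNReal.ofReal_div_of_pos hM, ENNReal.div_rpow_of_nonneg _ _ hp.le, hset,
    ENNReal.le_div_iff_mul_le (Or.inl (by simpa using fun h => absurd h hM.not_ge))
      (Or.inl (ENNReal.rpow_ne_top_of_nonneg hp.le ENNReal.ofReal_ne_top)), mul_comm]
  exact h.trans (ENNReal.rpow_le_rpow hu hp.le)

/-- If the limit quotient exceeded `M` at a point, the approximating quotients would do so from some
index on. That happens only on a null set, since `L / M < 1` makes the Markov bounds tend to zero.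
-/
theorem ae_holderQuotient_le_of_tendsto {p : ℕ → ℝ} (hp : ∀ n, 0 < p n)
    (hp_lim : Tendsto p atTop atTop) {w : ℕ → LqSpace Ω q} {u : LqSpace Ω q}
    (hw : ∀ᵐ x ∂(volume.restrict Ω), Tendsto (fun k => w k x) atTop (𝓝 (u x)))
    {L M : ℝ} (hM : 0 < M) (hLM : L < M)
    (hE : ∀ k, fracEnergy α (p k) (w k) ≤ ENNReal.ofReal L) :
    ∀ᵐ z ∂((volume.restrict Ω).prod (volume.restrict Ω)), holderQuotient α u z ≤ M := by
  have hlim : Tendsto (fun k => (ENNReal.ofReal (L / M)) ^ p k) atTop (𝓝 0) :=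
    (ENNReal.tendsto_rpow_atTop_of_base_lt_one
      (by rw [← ENNReal.ofReal_one, ENNReal.ofReal_lt_ofReal_iff one_pos]
          exact (div_lt_one hM).2 hLM)).comp hp_lim
  have hnot : ∀ᵐ z ∂((volume.restrict Ω).prod (volume.restrict Ω)),
      ∀ n, ∃ k ≥ n, ¬ M ≤ holderQuotient α (w k) z := by
    refine ae_all_iff.2 fun n => ?_
    rw [ae_iff]
    -- The points that are bad for every `k ≥ n` lie in each single bad set, whose measure is at
    -- most `(L / M) ^ p k`.
    refine le_antisymm (ge_of_tendsto hlim ?_) zero_le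
    filter_upwards [eventually_ge_atTop n] with k hk
    refine (measure_mono fun z hz => ?_).trans (measure_holderQuotient_ge_le (hp k) hM (hE k))
    simp only [mem_ofPred_eq, not_exists, not_and, not_not] at hz
    exact hz k hk
  filter_upwards [hnot, Measure.quasiMeasurePreserving_fst.ae hw,
    Measure.quasiMeasurePreserving_snd.ae hw] with z hz h1 h2
  by_contra! hlt
  obtain ⟨n, hn⟩ := eventually_atTop.1
    ((tendsto_holderQuotient (α := α) (w := fun k => (w k : EuclideanSpace ℝ (Fin N) → ℝ))
      h1 h2).eventually_const_lt hlt)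
  obtain ⟨k, hk, hk'⟩ := hz n
  exact hk' (hn k hk).le

/-- By Fubini, almost every `x` satisfies the estimate against almost every `y`. Two such points are
compared through a third point `y`, good for both and close to the first. The function is then
extended from this set of full measure. -/
theorem exists_holder_rep (hα0 : 0 < α) (hα1 : α ≤ 1) (hΩ : IsOpen Ω)
    {u : EuclideanSpace ℝ (Fin N) → ℝ} {M : ℝ} (hM : 0 ≤ M)
    (hu : ∀ᵐ z ∂((volume.restrict Ω).prod (volume.restrict Ω)), holderQuotient α u z ≤ M) :
    ∃ g, u =ᵐ[volume.restrict Ω] g ∧ ∀ x y, |g x - g y| ≤ M * ‖x - y‖ ^ α := by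
  set S := {x | x ∈ Ω ∧ ∀ᵐ y ∂(volume.restrict Ω), holderQuotient α u (x, y) ≤ M} with hS
  have hSae : ∀ᵐ x ∂(volume.restrict Ω), x ∈ S :=
    (ae_restrict_mem hΩ.measurableSet).and (Measure.ae_ae_of_ae_prod hu)
  suffices H : ∀ x ∈ S, ∀ y ∈ S, |u x - u y| ≤ M * ‖x - y‖ ^ α by
    obtain ⟨g, hug, hg⟩ := exists_holder_extension hα0 hα1 hM H
    exact ⟨g, hSae.mono fun x hx => hug hx, hg⟩
  intro x hx x' hx'
  by_contra! hlt
  have hF : Continuous fun y => M * ‖x - y‖ ^ α + M * ‖x' - y‖ ^ α := by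
    refine .add (.mul continuous_const ?_) (.mul continuous_const ?_) <;>
    exact (continuous_const.sub continuous_id).norm.rpow_const fun _ => Or.inr hα0.le
  -- At `y = x` the sum reduces to `M * ‖x' - x‖ ^ α`, so a violated estimate leaves an open
  -- neighbourhood of `x` of positive measure.
  have hU : IsOpen ({y | M * ‖x - y‖ ^ α + M * ‖x' - y‖ ^ α < |u x - u x'|} ∩ Ω) :=
    (isOpen_lt hF continuous_const).inter hΩ
  have hxU : x ∈ {y | M * ‖x - y‖ ^ α + M * ‖x' - y‖ ^ α < |u x - u x'|} ∩ Ω := by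
    refine ⟨?_, hx.1⟩
    simpa [Real.zero_rpow hα0.ne', norm_sub_rev x' x] using hlt
  have hpos : (volume.restrict Ω)
      ({y | M * ‖x - y‖ ^ α + M * ‖x' - y‖ ^ α < |u x - u x'|} ∩ Ω) ≠ 0 := by
    rw [Measure.restrict_apply hU.measurableSet, inter_assoc, inter_self]
    exact (hU.measure_pos _ ⟨x, hxU⟩).ne'
  obtain ⟨y, hy, hy1, hy2⟩ :=
    ((frequently_ae_mem_iff.2 hpos).and_eventually (hx.2.and hx'.2)).exists
  rw [holderQuotient_le_iff hM] at hy1 hy2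
  have h1 : M * ‖x - y‖ ^ α + M * ‖x' - y‖ ^ α < |u x - u x'| := hy.1
  have h2 := abs_sub_le (u x) (u y) (u x')
  rw [abs_sub_comm (u y)] at h2
  linarith

end Limit

/-! ### Comparison of averages over balls -/

section Averages

variable {N : ℕ} {Ω : Set (EuclideanSpace ℝ (Fin N))} {q α : ℝ}

/-- The difference is the mean of `u x - u y` over `A × B`. It is bounded by the `L^p` norm for the
normalised product measure, and normalising costs the factor `(|A| |B|) ^ (-1 / p)`. -/
theorem enorm_setAverage_sub_setAverage_le {p D : ℝ} (hp : 1 ≤ p) (hα0 : 0 ≤ α)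
    {u : LqSpace Ω q} {A B : Set (EuclideanSpace ℝ (Fin N))}
    (hAΩ : A ⊆ Ω) (hBΩ : B ⊆ Ω) (hA : MeasurableSet A) (hB : MeasurableSet B)
    (hA0 : volume A ≠ 0) (hB0 : volume B ≠ 0) (hA1 : volume A ≠ ∞) (hB1 : volume B ≠ ∞)
    (huA : IntegrableOn u A) (huB : IntegrableOn u B)
    (hD : ∀ x ∈ A, ∀ y ∈ B, ‖x - y‖ ≤ D) :
    ‖(⨍ x in A, u x) - ⨍ y in B, u y‖ₑ ≤
      ENNReal.ofReal (D ^ α) * (((volume A)⁻¹ * (volume B)⁻¹) ^ p⁻¹ * fracEnergy α p u) := by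
  have hp0 : 0 < p := one_pos.trans_le hp
  set μA := (volume A)⁻¹ • (volume : Measure (EuclideanSpace ℝ (Fin N))).restrict A with hμA
  set μB := (volume B)⁻¹ • (volume : Measure (EuclideanSpace ℝ (Fin N))).restrict B with hμB
  have iA : IsProbabilityMeasure μA :=
    ⟨by simp [hμA, ENNReal.inv_mul_cancel hA0 hA1]⟩
  have iB : IsProbabilityMeasure μB :=
    ⟨by simp [hμB, ENNReal.inv_mul_cancel hB0 hB1]⟩
  have uA : Integrable u μA := huA.smul_measure (ENNReal.inv_ne_top.2 hA0)
  have uB : Integrable u μB := huB.smul_measure (ENNReal.inv_ne_top.2 hB0)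
  have hint : (⨍ x in A, u x) - ⨍ y in B, u y = ∫ z, (u z.1 - u z.2) ∂(μA.prod μB) := by
    rw [setAverage_eq', setAverage_eq', integral_sub (uA.comp_fst μB) (uB.comp_snd μA),
      integral_fun_fst, integral_fun_snd]
    simp [hμA, hμB]
  have hprod : μA.prod μB = ((volume A)⁻¹ * (volume B)⁻¹) •
      ((volume.restrict A).prod (volume.restrict B)) := by
    rw [hμA, hμB, Measure.prod_smul_left, Measure.prod_smul_right, smul_smul]
  have hF : AEStronglyMeasurable (fun z : EuclideanSpace ℝ (Fin N) × EuclideanSpace ℝ (Fin N) =>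
      u z.1 - u z.2) (μA.prod μB) :=
    uA.aestronglyMeasurable.comp_fst.sub uB.aestronglyMeasurable.comp_snd
  rw [hint]
  calc ‖∫ z, (u z.1 - u z.2) ∂(μA.prod μB)‖ₑ
      ≤ eLpNorm (fun z => u z.1 - u z.2) 1 (μA.prod μB) := by
        rw [eLpNorm_one_eq_lintegral_enorm]; exact enorm_integral_le_lintegral_enorm _
    _ ≤ eLpNorm (fun z => u z.1 - u z.2) (ENNReal.ofReal p) (μA.prod μB) :=
        eLpNorm_le_eLpNorm_of_exponent_le (by simpa using hp) hF
    _ = ((volume A)⁻¹ * (volume B)⁻¹) ^ p⁻¹ * eLpNorm (fun z => u z.1 - u z.2) (ENNReal.ofReal p)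
          ((volume.restrict A).prod (volume.restrict B)) := by
        rw [hprod, eLpNorm_smul_measure_of_ne_top ENNReal.ofReal_ne_top,
          one_div, ENNReal.toReal_inv, ENNReal.toReal_ofReal hp0.le, smul_eq_mul]
    _ ≤ ((volume A)⁻¹ * (volume B)⁻¹) ^ p⁻¹ * (ENNReal.ofReal (D ^ α) * fracEnergy α p u) := by
        gcongr
        rw [fracEnergy_eq_eLpNorm hp0]
        refine (eLpNorm_le_mul_eLpNorm_of_ae_le_mul (g := holderQuotient α u) (c := D ^ α)
          ?_ _).trans ?_
        · filter_upwards [Measure.quasiMeasurePreserving_fst.ae (ae_restrict_mem hA),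
            Measure.quasiMeasurePreserving_snd.ae (ae_restrict_mem hB)] with z h1 h2
          rw [Real.norm_of_nonneg (holderQuotient_nonneg z), Real.norm_eq_abs, mul_comm]
          exact (abs_sub_le_holderQuotient_mul (α := α) z.1 z.2).trans
            (mul_le_mul_of_nonneg_left (Real.rpow_le_rpow (norm_nonneg _) (hD _ h1 _ h2) hα0)
              (holderQuotient_nonneg z))
        · gcongr
    _ = _ := by ring

/-- Here `a * t ^ N` stands for the volume of a ball of radius comparable to `t`. The condition `4 N
/ α ≤ p` makes the loss `t ^ (-2 N / p)` at most `t ^ (-α / 2)`, half of the gain `t ^ α`; `2 ≤ p`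
makes the constant independent of `p`. -/
theorem rpow_inv_mul_inv_le {a t p : ℝ} (hα0 : 0 < α) (ha : 0 < a) (ht : 0 < t) (ht1 : t ≤ 1)
    (hp2 : 2 ≤ p) (hpN : 4 * (N : ℝ) / α ≤ p) :
    ((a * t ^ N)⁻¹ * (a * t ^ N)⁻¹) ^ p⁻¹ ≤ max 1 a⁻¹ * t ^ (-(α / 2)) := by
  have hp0 : 0 < p := by linarith
  have h1 : ((a * t ^ N)⁻¹ * (a * t ^ N)⁻¹) ^ p⁻¹ =
      (a⁻¹) ^ (2 * p⁻¹) * (t⁻¹) ^ (2 * N * p⁻¹) := by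
    have : (a * t ^ N)⁻¹ * (a * t ^ N)⁻¹ = (a⁻¹) ^ (2 : ℝ) * (t⁻¹) ^ (2 * N : ℝ) := by
      rw [mul_inv, ← inv_pow, mul_comm (2 : ℝ), Real.rpow_mul (by positivity), Real.rpow_natCast,
        Real.rpow_two, Real.rpow_two]
      ring
    rw [this, Real.mul_rpow (by positivity) (by positivity), ← Real.rpow_mul (by positivity),
      ← Real.rpow_mul (by positivity)]
  rw [h1, Real.rpow_neg ht.le, ← Real.inv_rpow ht.le]
  have hN : 2 * N * p⁻¹ ≤ α / 2 := by
    rw [div_le_iff₀ hα0] at hpN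
    rw [← div_eq_mul_inv, div_le_iff₀ hp0]
    linarith
  gcongr
  · calc (a⁻¹) ^ (2 * p⁻¹) ≤ (max 1 a⁻¹) ^ (2 * p⁻¹) := by
          gcongr; exact le_max_right _ _
      _ ≤ (max 1 a⁻¹) ^ (1 : ℝ) := by
          refine Real.rpow_le_rpow_of_exponent_le (le_max_left _ _) ?_
          rw [← div_eq_mul_inv, div_le_one hp0]; exact hp2
      _ = _ := Real.rpow_one _
  · exact (one_le_inv₀ ht).2 ht1

theorem exists_dist_average_half_le (hα0 : 0 < α) {c : ℝ} (hc : 0 < c) (hc1 : c ≤ 1) :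
    ∃ C : ℝ, 0 ≤ C ∧ ∀ (x₀ e : EuclideanSpace ℝ (Fin N)) (t p L : ℝ) (u : LqSpace Ω q),
      ‖e‖ = 1 → 0 < t → t ≤ 1 → 2 ≤ p → 4 * (N : ℝ) / α ≤ p → 0 ≤ L →
      Metric.ball (x₀ + t • e) (c * t) ⊆ Ω →
      Metric.ball (x₀ + (t / 2) • e) (c * (t / 2)) ⊆ Ω →
      IntegrableOn u Ω → fracEnergy α p u ≤ ENNReal.ofReal L →
      dist (⨍ x in Metric.ball (x₀ + t • e) (c * t), u x)
        (⨍ x in Metric.ball (x₀ + (t / 2) • e) (c * (t / 2)), u x) ≤ C * L * t ^ (α / 2) := by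
  set v := (volume (Metric.ball (0 : EuclideanSpace ℝ (Fin N)) 1)).toReal with hv
  have hv0 : 0 < v := ENNReal.toReal_pos (Metric.measure_ball_pos _ _ one_pos).ne'
    measure_ball_lt_top.ne
  -- `a * t ^ N` is the volume of the smaller ball, of radius `c * t / 2`, and bounds both volumes
  -- from below.
  set a := (c / 2) ^ N * v with ha
  have ha0 : 0 < a := by positivity
  refine ⟨4 ^ α * max 1 a⁻¹, by positivity, ?_⟩
  intro x₀ e t p L u he ht ht1 hp2 hpN hL hA hB hu hE
  have hvol : ∀ (x : EuclideanSpace ℝ (Fin N)) (r : ℝ), c / 2 * t ≤ r →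
      ENNReal.ofReal (a * t ^ N) ≤ volume (Metric.ball x r) := by
    intro x r hr
    have hr0 : 0 < r := lt_of_lt_of_le (by positivity) hr
    rw [Measure.addHaar_ball_of_pos volume x hr0, finrank_euclideanSpace_fin,
      ← ENNReal.ofReal_toReal (measure_ball_lt_top (x := (0 : EuclideanSpace ℝ (Fin N)))
        (r := 1) (μ := volume)).ne, ← hv, ← ENNReal.ofReal_mul (by positivity)]
    refine ENNReal.ofReal_le_ofReal ?_
    rw [ha, mul_right_comm, ← mul_pow]
    gcongr
  have hm : 0 < a * t ^ N := by positivity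
  have hVA := hvol (x₀ + t • e) (c * t) (by nlinarith)
  have hVB := hvol (x₀ + (t / 2) • e) (c * (t / 2)) (by linarith)
  have hpos : 0 < ENNReal.ofReal (a * t ^ N) := ENNReal.ofReal_pos.2 hm
  have hnear : ∀ s : ℝ, 0 < s → ∀ x ∈ Metric.ball (x₀ + s • e) (c * s), ‖x - x₀‖ ≤ 2 * s := by
    intro s hs x hx
    have h1 : ‖x - (x₀ + s • e)‖ < c * s := by rwa [← dist_eq_norm]
    have h2 : x - x₀ = (x - (x₀ + s • e)) + s • e := by abel
    have h3 : ‖s • e‖ = s := by rw [norm_smul, he, mul_one, Real.norm_of_nonneg hs.le]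
    rw [h2]
    refine (norm_add_le _ _).trans ?_
    rw [h3]
    nlinarith
  -- The balls lie within `2 * t` and `t` of `x₀`, so `4 * t` bounds the mutual distances with room
  -- to spare.
  have key := enorm_setAverage_sub_setAverage_le (α := α) (p := p) (D := 4 * t) (u := u)
    (by linarith) hα0.le hA hB
    measurableSet_ball measurableSet_ball (hpos.trans_le hVA).ne' (hpos.trans_le hVB).ne'
    measure_ball_lt_top.ne measure_ball_lt_top.ne (hu.mono_set hA) (hu.mono_set hB) (by
      intro x hx y hy
      have h1 := hnear t ht x hx
      have h2 := hnear (t / 2) (by positivity) y hy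
      have h3 : x - y = (x - x₀) - (y - x₀) := by abel
      rw [h3]
      refine (norm_sub_le _ _).trans ?_
      linarith)
  rw [← edist_eq_enorm_sub, edist_dist] at key
  have hinv : ∀ V : ℝ≥0∞, ENNReal.ofReal (a * t ^ N) ≤ V →
      V⁻¹ ≤ ENNReal.ofReal (a * t ^ N)⁻¹ := fun V hV => by
    rw [ENNReal.ofReal_inv_of_pos hm]; exact ENNReal.inv_le_inv.2 hV
  have hp0 : 0 < p := by linarith
  have hbound : ENNReal.ofReal (dist (⨍ x in Metric.ball (x₀ + t • e) (c * t), u x)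
      (⨍ x in Metric.ball (x₀ + (t / 2) • e) (c * (t / 2)), u x)) ≤
      ENNReal.ofReal ((4 * t) ^ α * (((a * t ^ N)⁻¹ * (a * t ^ N)⁻¹) ^ p⁻¹ * L)) := by
    refine key.trans ?_
    rw [ENNReal.ofReal_mul (by positivity), ENNReal.ofReal_mul (by positivity),
      ← ENNReal.ofReal_rpow_of_nonneg (p := p⁻¹) (by positivity) (by positivity),
      ENNReal.ofReal_mul (by positivity)]
    gcongr
    · exact hinv _ hVA
    · exact hinv _ hVB
  refine ((ENNReal.ofReal_le_ofReal_iff (by positivity)).1 hbound).trans ?_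
  calc (4 * t) ^ α * (((a * t ^ N)⁻¹ * (a * t ^ N)⁻¹) ^ p⁻¹ * L)
      ≤ (4 * t) ^ α * ((max 1 a⁻¹ * t ^ (-(α / 2))) * L) := by
        gcongr; exact rpow_inv_mul_inv_le hα0 ha0 ht ht1 hp2 hpN
    _ = 4 ^ α * max 1 a⁻¹ * L * (t ^ α * t ^ (-(α / 2))) := by
        rw [Real.mul_rpow (by norm_num) ht.le]; ring
    _ = _ := by
        rw [← Real.rpow_add ht]; congr 2; ring

end Averages

/-! ### Interior cones and stability of the boundary values -/

section Boundary

variable {N : ℕ} {Ω : Set (EuclideanSpace ℝ (Fin N))} {q α : ℝ}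

theorem IsBoundedLipschitzDomain.exists_interior_cone (hΩ : IsBoundedLipschitzDomain Ω)
    {x₀ : EuclideanSpace ℝ (Fin N)} (hx₀ : x₀ ∈ frontier Ω) :
    ∃ (e : EuclideanSpace ℝ (Fin N)) (c t₀ : ℝ), ‖e‖ = 1 ∧ 0 < c ∧ c ≤ 1 ∧ 0 < t₀ ∧
      ∀ t, 0 < t → t ≤ t₀ → Metric.ball (x₀ + t • e) (c * t) ⊆ Ω := by
  obtain ⟨r, e, K, γ, hr, he, hγ, hiff⟩ := hΩ.locally_epigraph x₀ hx₀
  have hee : (inner ℝ e e : ℝ) = 1 := by rw [real_inner_self_eq_norm_sq, he, one_pow]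
  -- Points of `Ω` near `x₀` lie above the graph; passing to the closure gives the weak inequality
  -- at `x₀`.
  have hbase : γ (x₀ - (inner ℝ e x₀ : ℝ) • e) ≤ (inner ℝ e x₀ : ℝ) := by
    have hcl : x₀ ∈ closure (Metric.ball x₀ r ∩ Ω) :=
      Metric.isOpen_ball.inter_closure ⟨Metric.mem_ball_self hr, frontier_subset_closure hx₀⟩
    have hγc := hγ.continuous
    have hclosed : IsClosed {x | γ (x - (inner ℝ e x : ℝ) • e) ≤ (inner ℝ e x : ℝ)} :=
      isClosed_le (by fun_prop) (by fun_prop)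
    exact closure_minimal (fun x hx => ((hiff x hx.1).1 hx.2).le) hclosed hcl
  have hK : (0 : ℝ) ≤ K := K.2
  -- A perturbation `z` lowers the height by at most `‖z‖` and raises `γ` by at most `2 * K * ‖z‖`.
  -- The total stays below the climb `t` when `‖z‖ < t / (2 * K + 1)`.
  set c : ℝ := 1 / (2 * K + 1) with hc
  have hc0 : 0 < c := by positivity
  have hcK : c * (2 * K + 1) = 1 := by rw [hc]; field_simp
  have hc1 : c ≤ 1 := by nlinarith
  refine ⟨e, c, r / 2, he, hc0, hc1, by positivity, fun t ht htr x hx => ?_⟩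
  set z := x - (x₀ + t • e) with hz
  have hzn : ‖z‖ < c * t := by rwa [hz, ← dist_eq_norm]
  have hxz : x = x₀ + t • e + z := by rw [hz]; abel
  have hez : |(inner ℝ e z : ℝ)| ≤ ‖z‖ := by
    have := abs_real_inner_le_norm e z
    rwa [he, one_mul] at this
  have hinner : (inner ℝ e x : ℝ) = inner ℝ e x₀ + t + inner ℝ e z := by
    rw [hxz, inner_add_right, inner_add_right, inner_smul_right, hee, mul_one]
  have hxball : x ∈ Metric.ball x₀ r := by
    rw [Metric.mem_ball, dist_eq_norm]
    have h1 : x - x₀ = t • e + z := by rw [hxz]; abel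
    have h2 : ‖t • e‖ = t := by rw [norm_smul, he, mul_one, Real.norm_of_nonneg ht.le]
    rw [h1]
    refine (norm_add_le _ _).trans_lt ?_
    rw [h2]
    nlinarith
  rw [hiff x hxball]
  have hproj : x - (inner ℝ e x : ℝ) • e - (x₀ - (inner ℝ e x₀ : ℝ) • e) =
      z - (inner ℝ e z : ℝ) • e := by
    rw [hinner, hxz]
    module
  have hlip := hγ.dist_le_mul (x - (inner ℝ e x : ℝ) • e) (x₀ - (inner ℝ e x₀ : ℝ) • e)
  rw [Real.dist_eq, dist_eq_norm, hproj] at hlip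
  have hpn : ‖z - (inner ℝ e z : ℝ) • e‖ ≤ 2 * ‖z‖ := by
    refine (norm_sub_le _ _).trans ?_
    rw [norm_smul, he, mul_one, Real.norm_eq_abs]
    linarith
  have h1 := le_abs_self (γ (x - (inner ℝ e x : ℝ) • e) - γ (x₀ - (inner ℝ e x₀ : ℝ) • e))
  have h2 : (K : ℝ) * ‖z - (inner ℝ e z : ℝ) • e‖ ≤ K * (2 * ‖z‖) := by gcongr
  have h3 := neg_abs_le (inner ℝ e z : ℝ)
  have h4 : (2 * (K : ℝ) + 1) * ‖z‖ < (2 * K + 1) * (c * t) := by gcongr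
  have h5 : (2 * (K : ℝ) + 1) * (c * t) = t := by rw [← mul_assoc, mul_comm _ c, hcK, one_mul]
  linarith

theorem tendsto_average_ball {u g : EuclideanSpace ℝ (Fin N) → ℝ}
    (hg : ContinuousOn g (closure Ω)) (hug : u =ᵐ[volume.restrict Ω] g)
    (hu : IntegrableOn u Ω) {x₀ e : EuclideanSpace ℝ (Fin N)}
    (hx₀ : x₀ ∈ closure Ω) (he : ‖e‖ = 1) {c : ℝ} (hc0 : 0 < c) (hc1 : c ≤ 1) {s : ℕ → ℝ}
    (hs0 : ∀ n, 0 < s n) (hs : Tendsto s atTop (𝓝 0))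
    (hball : ∀ n, Metric.ball (x₀ + s n • e) (c * s n) ⊆ Ω) :
    Tendsto (fun n => ⨍ x in Metric.ball (x₀ + s n • e) (c * s n), u x) atTop (𝓝 (g x₀)) := by
  rw [Metric.nhds_basis_closedBall.tendsto_right_iff]
  intro ε hε
  obtain ⟨δ, hδ, hδ'⟩ := Metric.continuousWithinAt_iff.1 (hg x₀ hx₀) ε hε
  filter_upwards [hs.eventually_lt_const (show 0 < δ / 2 by positivity)] with n hn
  refine (convex_closedBall (g x₀) ε).set_average_mem Metric.isClosed_closedBall
    (Metric.measure_ball_pos _ _ (mul_pos hc0 (hs0 n))).ne' measure_ball_lt_top.ne ?_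
    (hu.mono_set (hball n))
  filter_upwards [ae_restrict_mem measurableSet_ball,
    ae_restrict_of_ae_restrict_of_subset (hball n) hug] with x hx hux
  rw [hux]
  refine Metric.mem_closedBall.2 (hδ' (subset_closure (hball n hx)) ?_).le
  have h1 : dist x (x₀ + s n • e) < c * s n := hx
  have h2 : dist (x₀ + s n • e) x₀ = s n := by
    rw [dist_eq_norm, add_sub_cancel_left, norm_smul, he, mul_one,
      Real.norm_of_nonneg (hs0 n).le]
  have h3 := dist_triangle x (x₀ + s n • e) x₀
  nlinarith [hs0 n]

theorem tendsto_setAverage_of_tendsto_Lp [hq : Fact (1 ≤ ENNReal.ofReal q)]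
    (hΩ : volume Ω ≠ ∞) {w : ℕ → LqSpace Ω q} {u : LqSpace Ω q} (hw : Tendsto w atTop (𝓝 u))
    {B : Set (EuclideanSpace ℝ (Fin N))} (hBΩ : B ⊆ Ω) :
    Tendsto (fun n => ⨍ x in B, w n x) atTop (𝓝 (⨍ x in B, u x)) := by
  have : IsFiniteMeasure ((volume : Measure (EuclideanSpace ℝ (Fin N))).restrict Ω) :=
    isFiniteMeasure_restrict.2 hΩ
  have h1 : Tendsto (fun n => eLpNorm (w n - u : EuclideanSpace ℝ (Fin N) → ℝ) 1
      (volume.restrict Ω)) atTop (𝓝 0) := by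
    have h := (Lp.tendsto_Lp_iff_tendsto_eLpNorm' w u).1 hw
    have hb := ENNReal.Tendsto.mul_const (b := (volume.restrict Ω) univ ^
      (1 / (1 : ℝ≥0∞).toReal - 1 / (ENNReal.ofReal q).toReal)) h
      (Or.inr (ENNReal.rpow_ne_top_of_nonneg (by
        have h1 := ENNReal.toReal_mono ENNReal.ofReal_ne_top hq.out
        rw [ENNReal.toReal_one] at h1 ⊢
        rw [one_div_one, sub_nonneg]
        exact div_le_one_of_le₀ h1 (by positivity)) (measure_ne_top _ _)))
    rw [zero_mul] at hb
    exact tendsto_of_tendsto_of_tendsto_of_le_of_le tendsto_const_nhds hb (fun _ => zero_le)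
      fun n => eLpNorm_le_eLpNorm_mul_rpow_measure_univ hq.out
        ((Lp.aestronglyMeasurable _).sub (Lp.aestronglyMeasurable _))
  have h2 := tendsto_setIntegral_of_L1' u (Lp.aestronglyMeasurable u)
    (Eventually.of_forall fun n => (Lp.memLp (w n)).integrable hq.out) h1 B
  rw [Measure.restrict_restrict_of_subset hBΩ] at h2
  simp only [setAverage_eq]
  exact h2.const_smul _

/-- The order of limits matters: a bound at height `t` uniform in the sequence, then the `L^q` limit
at fixed `t`, and only then `t → 0`. -/
theorem eqOn_frontier_of_tendsto [hq : Fact (1 ≤ ENNReal.ofReal q)]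
    (hΩ : IsBoundedLipschitzDomain Ω) (hα0 : 0 < α) {φ : EuclideanSpace ℝ (Fin N) → ℝ}
    {p : ℕ → ℝ} (hp2 : ∀ n, 2 ≤ p n) (hpN : ∀ n, 4 * (N : ℝ) / α ≤ p n)
    {w : ℕ → LqSpace Ω q} {u : LqSpace Ω q} (hw : Tendsto w atTop (𝓝 u))
    (hwφ : ∀ n, HasBoundaryValues (w n) φ) {L : ℝ} (hL : 0 ≤ L)
    (hE : ∀ n, fracEnergy α (p n) (w n) ≤ ENNReal.ofReal L)
    {g : EuclideanSpace ℝ (Fin N) → ℝ} (hg : IsContinuousRep u g) :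
    EqOn g φ (frontier Ω) := by
  intro x₀ hx₀
  have hx₀' : x₀ ∈ closure Ω := frontier_subset_closure hx₀
  have hvol : volume Ω ≠ ∞ := hΩ.isBounded.measure_lt_top.ne
  have : IsFiniteMeasure ((volume : Measure (EuclideanSpace ℝ (Fin N))).restrict Ω) :=
    isFiniteMeasure_restrict.2 hvol
  have hint : ∀ v : LqSpace Ω q, IntegrableOn v Ω := fun v => (Lp.memLp v).integrable hq.out
  obtain ⟨e, c, t₀, he, hc0, hc1, ht₀, hball⟩ := hΩ.exists_interior_cone hx₀
  obtain ⟨C, hC, hstep⟩ := exists_dist_average_half_le (Ω := Ω) (q := q) hα0 hc0 hc1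
  have hhalf : ∀ t : ℝ, Tendsto (fun n : ℕ => t / 2 ^ n) atTop (𝓝 0) := fun t =>
    tendsto_const_nhds.div_atTop (tendsto_pow_atTop_atTop_of_one_lt one_lt_two)
  -- Halving `t` multiplies `t ^ (α / 2)` by `ρ`, so the dyadic increments are dominated by a
  -- geometric series.
  set ρ : ℝ := (1 / 2) ^ (α / 2) with hρ
  have hρ1 : ρ < 1 := Real.rpow_lt_one (by norm_num) (by norm_num) (by positivity)
  have hle : ∀ t : ℝ, 0 < t → t ≤ min t₀ 1 → ∀ n : ℕ, 0 < t / 2 ^ n ∧ t / 2 ^ n ≤ min t₀ 1 :=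
    fun t ht ht1 n => ⟨by positivity, (div_le_self ht.le (one_le_pow₀ one_le_two)).trans ht1⟩
  have hwbound : ∀ t : ℝ, 0 < t → t ≤ min t₀ 1 → ∀ k,
      dist (⨍ x in Metric.ball (x₀ + t • e) (c * t), w k x) (φ x₀) ≤
        C * L * t ^ (α / 2) / (1 - ρ) := by
    intro t ht ht1 k
    obtain ⟨gk, hgk, hgkφ⟩ := hwφ k
    rw [← hgkφ hx₀]
    have hlim := tendsto_average_ball hgk.1 hgk.2 (hint _) hx₀' he hc0 hc1
      (fun n => (hle t ht ht1 n).1) (hhalf t)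
      (fun n => hball _ (hle t ht ht1 n).1 ((hle t ht ht1 n).2.trans (min_le_left _ _)))
    have := dist_le_of_le_geometric_of_tendsto₀ ρ (C * L * t ^ (α / 2)) hρ1 (fun n => ?_) hlim
    · simpa using this
    · have h := hle t ht ht1 n
      have h' := hle t ht ht1 (n + 1)
      have heq : t / 2 ^ (n + 1) = t / 2 ^ n / 2 := by rw [pow_succ, div_div]
      rw [heq] at h' ⊢
      refine (hstep x₀ e (t / 2 ^ n) (p k) L (w k) he h.1 (h.2.trans (min_le_right _ _)) (hp2 k)
        (hpN k) hL (hball _ h.1 (h.2.trans (min_le_left _ _)))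
        (hball _ h'.1 (h'.2.trans (min_le_left _ _))) (hint _) (hE k)).trans (le_of_eq ?_)
      rw [mul_assoc (C * L), hρ, Real.rpow_pow_comm (by norm_num), ← Real.mul_rpow ht.le (by positivity), one_div_pow, mul_one_div]
  have hubound : ∀ t : ℝ, 0 < t → t ≤ min t₀ 1 →
      dist (⨍ x in Metric.ball (x₀ + t • e) (c * t), u x) (φ x₀) ≤
        C * L * t ^ (α / 2) / (1 - ρ) := fun t ht ht1 =>
    le_of_tendsto ((tendsto_setAverage_of_tendsto_Lp hvol hw
      (hball t ht (ht1.trans (min_le_left _ _)))).dist tendsto_const_nhds)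
      (Eventually.of_forall fun k => hwbound t ht ht1 k)
  set t := min t₀ 1 with ht
  have ht0 : 0 < t := lt_min ht₀ one_pos
  have hlim := tendsto_average_ball hg.1 hg.2 (hint _) hx₀' he hc0 hc1
    (fun n => (hle t ht0 le_rfl n).1) (hhalf t)
    (fun n => hball _ (hle t ht0 le_rfl n).1 ((hle t ht0 le_rfl n).2.trans (min_le_left _ _)))
  have hzero : Tendsto (fun n : ℕ => C * L * (t / 2 ^ n) ^ (α / 2) / (1 - ρ)) atTop (𝓝 0) := by
    have h := (hhalf t).rpow_const (p := α / 2) (Or.inr (by positivity))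
    rw [Real.zero_rpow (by positivity)] at h
    simpa using (h.const_mul (C * L)).div_const (1 - ρ)
  exact dist_le_zero.1 (le_of_tendsto_of_tendsto' (hlim.dist tendsto_const_nhds) hzero fun n =>
    hubound _ (hle t ht0 le_rfl n).1 (hle t ht0 le_rfl n).2)

end Boundary

/-! ### The Γ-limit and the limit of minimizers -/

section GammaLimit

variable {N : ℕ} {Ω : Set (EuclideanSpace ℝ (Fin N))} {q α : ℝ}

theorem constrainedEnergyInfty_le_of_forall_le [hq : Fact (1 ≤ ENNReal.ofReal q)]
    (hΩ : IsBoundedLipschitzDomain Ω) (hα0 : 0 < α) (hα1 : α ≤ 1)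
    {φ : EuclideanSpace ℝ (Fin N) → ℝ} {p : ℕ → ℝ} (hp2 : ∀ n, 2 ≤ p n)
    (hpN : ∀ n, 4 * (N : ℝ) / α ≤ p n) (hp_lim : Tendsto p atTop atTop)
    {w : ℕ → LqSpace Ω q} {u : LqSpace Ω q} (hw : Tendsto w atTop (𝓝 u))
    (hwφ : ∀ n, HasBoundaryValues (w n) φ) {L : ℝ} (hL : 0 ≤ L)
    (hE : ∀ n, fracEnergy α (p n) (w n) ≤ ENNReal.ofReal L) :
    constrainedEnergyInfty Ω q α φ u ≤ ENNReal.ofReal L := by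
  -- The slack `ε` provides the threshold `M = L + ε > L` that the Markov argument requires.
  refine ENNReal.le_of_forall_pos_le_add fun ε hε _ => ?_
  have hε' : (0 : ℝ) < ε := hε
  rw [← ENNReal.ofReal_coe_nnreal, ← ENNReal.ofReal_add hL hε'.le]
  have hM : 0 < L + ε := by positivity
  obtain ⟨ns, hns, hae⟩ := (tendstoInMeasure_of_tendsto_Lp hw).exists_seq_tendsto_ae
  have hbound := ae_holderQuotient_le_of_tendsto (p := fun k => p (ns k))
    (w := fun k => w (ns k)) (fun k => two_pos.trans_le (hp2 _))
    (hp_lim.comp hns.tendsto_atTop) hae hM (by linarith) (fun k => hE (ns k))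
  obtain ⟨g, hug, hg⟩ := exists_holder_rep hα0 hα1 hΩ.isOpen hM.le hbound
  have hrep : IsContinuousRep u g := ⟨(continuous_of_holder hα0 hg).continuousOn, hug⟩
  have hle : holderClosure α u ≤ ENNReal.ofReal (L + ε) := by
    rw [holderClosure_eq α hΩ.isOpen hrep, holderSup_le_iff hM.le]
    exact fun x _ y _ => hg x y
  rw [constrainedEnergyInfty, if_pos]
  · exact hle
  · exact ⟨hle.trans_lt ENNReal.ofReal_lt_top, g, hrep,
      eqOn_frontier_of_tendsto hΩ hα0 hp2 hpN hw hwφ hL hE hrep⟩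

/-- If the inequality failed, some `b` below the limit energy would bound the energies along a
subsequence. Finiteness makes these terms admissible, and the subsequence can be chosen with `p`
above the thresholds `2` and `4 N / α`, so the bounded case applies. -/
theorem constrainedEnergyInfty_le_liminf [hq : Fact (1 ≤ ENNReal.ofReal q)]
    (hΩ : IsBoundedLipschitzDomain Ω) (hα0 : 0 < α) (hα1 : α ≤ 1)
    {φ : EuclideanSpace ℝ (Fin N) → ℝ} {p : ℕ → ℝ} (hp_lim : Tendsto p atTop atTop)
    {w : ℕ → LqSpace Ω q} {u : LqSpace Ω q} (hw : Tendsto w atTop (𝓝 u)) :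
    constrainedEnergyInfty Ω q α φ u ≤
      liminf (fun n => constrainedEnergy Ω q α (p n) φ (w n)) atTop := by
  by_contra! hlt
  obtain ⟨b, hb, hbu⟩ := exists_between hlt
  obtain ⟨ns, hns, hP⟩ := extraction_of_frequently_atTop
    ((frequently_lt_of_liminf_lt (by isBoundedDefault) hb).and_eventually
      ((hp_lim.eventually_ge_atTop 2).and (hp_lim.eventually_ge_atTop (4 * (N : ℝ) / α))))
  have hadm : ∀ k, w (ns k) ∈ admissible Ω q α (p (ns k)) φ := fun k => by
    by_contra hk
    have := (hP k).1
    rw [constrainedEnergy, if_neg hk] at this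
    exact not_top_lt this
  refine hbu.not_ge ?_
  rw [← ENNReal.ofReal_toReal hbu.ne_top]
  refine constrainedEnergyInfty_le_of_forall_le hΩ hα0 hα1 (fun k => (hP k).2.1)
    (fun k => (hP k).2.2) (hp_lim.comp hns.tendsto_atTop) (hw.comp hns.tendsto_atTop)
    (fun k => (hadm k).2) ENNReal.toReal_nonneg fun k => ?_
  rw [ENNReal.ofReal_toReal hbu.ne_top]
  have := (hP k).1
  rw [constrainedEnergy, if_pos (hadm k)] at this
  exact this.le

theorem limsup_constrainedEnergy_le (hΩ : IsBoundedLipschitzDomain Ω)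
    {φ : EuclideanSpace ℝ (Fin N) → ℝ} {p : ℕ → ℝ} (hp : ∀ n, 0 < p n)
    (hp_lim : Tendsto p atTop atTop) (u : LqSpace Ω q) :
    limsup (fun n => constrainedEnergy Ω q α (p n) φ u) atTop ≤
      constrainedEnergyInfty Ω q α φ u := by
  by_cases hu : u ∈ admissibleInfty Ω q α φ
  swap
  · rw [constrainedEnergyInfty, if_neg hu]; exact le_top
  rw [constrainedEnergyInfty, if_pos hu]
  obtain ⟨hfin, g, hg, hgφ⟩ := hu
  have hvol : volume Ω ≠ ∞ := hΩ.isBounded.measure_lt_top.ne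
  have hvol0 : volume Ω ≠ 0 := (hΩ.isOpen.measure_pos _ hΩ.isConnected.nonempty).ne'
  have hhol : ∀ x ∈ closure Ω, ∀ y ∈ closure Ω,
      |g x - g y| ≤ (holderClosure α u).toReal * ‖x - y‖ ^ α := by
    rw [← holderSup_le_iff ENNReal.toReal_nonneg, ENNReal.ofReal_toReal hfin.ne,
      holderClosure_eq α hΩ.isOpen hg]
  have hle : ∀ n, fracEnergy α (p n) u ≤
      (volume Ω * volume Ω) ^ (p n)⁻¹ * holderClosure α u := fun n => by
    have := fracEnergy_le_of_holder (hp n) hg.2 hΩ.isOpen.measurableSet ENNReal.toReal_nonneg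
      fun x hx y hy => hhol x (subset_closure hx) y (subset_closure hy)
    rwa [ENNReal.ofReal_toReal hfin.ne] at this
  have hlim := tendsto_rpow_inv_mul (mul_ne_zero hvol0 hvol0) (ENNReal.mul_ne_top hvol hvol)
    hfin.ne hp_lim
  rw [← hlim.limsup_eq]
  refine limsup_le_limsup (Eventually.of_forall fun n => ?_)
  have hpow : (volume Ω * volume Ω) ^ (p n)⁻¹ ≠ ∞ :=
    ENNReal.rpow_ne_top_of_nonneg (inv_nonneg.2 (hp n).le) (ENNReal.mul_ne_top hvol hvol)
  beta_reduce
  rw [constrainedEnergy, if_pos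
    ⟨(hle n).trans_lt (ENNReal.mul_lt_top hpow.lt_top hfin), g, hg, hgφ⟩]
  exact hle n

/-- Rules out that the limit functional is identically `∞`, in which case minimality would not imply
admissibility. -/
theorem exists_constrainedEnergyInfty_lt_top (hΩ : IsBoundedLipschitzDomain Ω)
    (hα0 : 0 < α) (hα1 : α ≤ 1) {φ : EuclideanSpace ℝ (Fin N) → ℝ} {C : ℝ≥0}
    (hφ : HolderOnWith C α.toNNReal φ (frontier Ω)) :
    ∃ v : LqSpace Ω q, constrainedEnergyInfty Ω q α φ v < ∞ := by
  obtain ⟨g, hφg, hg⟩ := exists_holder_extension hα0 hα1 C.2 (f := φ) (S := frontier Ω)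
    fun x hx y hy => by
      have := hφ.dist_le hx hy
      rwa [Real.dist_eq, dist_eq_norm, Real.coe_toNNReal _ hα0.le] at this
  have hgc := continuous_of_holder hα0 hg
  have : IsFiniteMeasure ((volume : Measure (EuclideanSpace ℝ (Fin N))).restrict Ω) :=
    isFiniteMeasure_restrict.2 hΩ.isBounded.measure_lt_top.ne
  obtain ⟨B, hB⟩ := hΩ.isBounded.isCompact_closure.exists_bound_of_continuousOn hgc.continuousOn
  have hmem : MemLp g (ENNReal.ofReal q) (volume.restrict Ω) :=
    MemLp.of_bound hgc.aestronglyMeasurable B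
      ((ae_restrict_mem hΩ.isOpen.measurableSet).mono fun x hx => hB x (subset_closure hx))
  have hrep : IsContinuousRep (hmem.toLp g : LqSpace Ω q) g :=
    ⟨hgc.continuousOn, hmem.coeFn_toLp⟩
  have hfin : holderClosure α (hmem.toLp g : LqSpace Ω q) < ∞ := by
    rw [holderClosure_eq α hΩ.isOpen hrep]
    exact ((holderSup_le_iff C.2).2 fun x _ y _ => hg x y).trans_lt ENNReal.ofReal_lt_top
  refine ⟨hmem.toLp g, ?_⟩
  rw [constrainedEnergyInfty, if_pos ⟨hfin, g, hrep, hφg.symm⟩]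
  exact hfin

theorem isMinimizerIn_admissibleInfty {φ : EuclideanSpace ℝ (Fin N) → ℝ} {u : LqSpace Ω q}
    (hfin : ∃ v : LqSpace Ω q, constrainedEnergyInfty Ω q α φ v < ∞)
    (hu : ∀ v, constrainedEnergyInfty Ω q α φ u ≤ constrainedEnergyInfty Ω q α φ v) :
    IsMinimizerIn (constrainedEnergyInfty Ω q α φ) (admissibleInfty Ω q α φ) u := by
  refine ⟨?_, fun v _ => hu v⟩
  obtain ⟨v, hv⟩ := hfin
  by_contra h
  have := (hu v).trans_lt hv
  rw [constrainedEnergyInfty, if_neg h] at this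
  exact not_top_lt this

theorem IsMinimizerIn.constrainedEnergy_le {p : ℝ} {φ : EuclideanSpace ℝ (Fin N) → ℝ}
    {w : LqSpace Ω q}
    (hw : IsMinimizerIn (constrainedEnergy Ω q α p φ) (admissible Ω q α p φ) w)
    (v : LqSpace Ω q) : constrainedEnergy Ω q α p φ w ≤ constrainedEnergy Ω q α p φ v := by
  by_cases hv : v ∈ admissible Ω q α p φ
  · exact hw.2 v hv
  · rw [constrainedEnergy.eq_def Ω q α p φ v, if_neg hv]; exact le_top

end GammaLimit

/-- The instance `Fact (1 ≤ q)` only makes the metric of `L^q(Ω)` available; it follows from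
`2 N / α < q`, `1 ≤ N` and `α < 1`. -/
theorem mainTheorem2 (N : ℕ) (hN : 1 ≤ N) (α q : ℝ) (hα0 : 0 < α) (hα1 : α < 1)
    (hq : 2 * (N : ℝ) / α < q) [Fact (1 ≤ ENNReal.ofReal q)]
    (Ω : Set (EuclideanSpace ℝ (Fin N))) (hΩ : IsBoundedLipschitzDomain Ω)
    (φ : EuclideanSpace ℝ (Fin N) → ℝ)
    (hφ : ∃ C : ℝ≥0, HolderOnWith C α.toNNReal φ (frontier Ω))
    (p : ℕ → ℝ) (hp : ∀ n, 2 * (N : ℝ) / α < p n) (hp_lim : Tendsto p atTop atTop) :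
    GammaConverges (fun n => constrainedEnergy Ω q α (p n) φ)
      (constrainedEnergyInfty Ω q α φ) ∧
    ∀ (w : ℕ → LqSpace Ω q) (u : LqSpace Ω q),
      (∀ n, IsMinimizerIn (constrainedEnergy Ω q α (p n) φ) (admissible Ω q α (p n) φ) (w n)) →
      Tendsto w atTop (𝓝 u) →
      IsMinimizerIn (constrainedEnergyInfty Ω q α φ) (admissibleInfty Ω q α φ) u := by
  have hp0 : ∀ n, 0 < p n := fun n => lt_of_le_of_lt (by positivity) (hp n)
  obtain ⟨C, hC⟩ := hφ
  refine ⟨⟨fun u w hw => constrainedEnergyInfty_le_liminf hΩ hα0 hα1.le hp_lim hw,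
    fun u => ⟨fun _ => u, tendsto_const_nhds, limsup_constrainedEnergy_le hΩ hp0 hp_lim u⟩⟩,
    fun w u hmin hw => ?_⟩
  refine isMinimizerIn_admissibleInfty
    (exists_constrainedEnergyInfty_lt_top hΩ hα0 hα1.le hC) fun v => ?_
  calc constrainedEnergyInfty Ω q α φ u
      ≤ liminf (fun n => constrainedEnergy Ω q α (p n) φ (w n)) atTop :=
        constrainedEnergyInfty_le_liminf hΩ hα0 hα1.le hp_lim hw
    _ ≤ liminf (fun n => constrainedEnergy Ω q α (p n) φ v) atTop :=
        liminf_le_liminf (Eventually.of_forall fun n => (hmin n).constrainedEnergy_le v)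
    _ ≤ limsup (fun n => constrainedEnergy Ω q α (p n) φ v) atTop := liminf_le_limsup
    _ ≤ constrainedEnergyInfty Ω q α φ v := limsup_constrainedEnergy_le hΩ hp0 hp_lim v
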